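/- Let $p$ be a prime and let $\mathcal T$ be the $p$-adic rooted tree, whose vertices are the finite words in the alphabet $X=\{1,\dots,p\}$. Let $a\in\operatorname{Aut}\mathcal T$ be the automorphism that permutes the first letter of every non-empty word by the cycle $(1\,2\,\dots\,p)$ and fixes all the other letters. A GGS-group is a subgroup $G=\langle a,c\rangle\le\operatorname{Aut}\mathcal T$ where, for some non-zero vector $(e_1,\dots,e_{p-1})\in\mathbb F_p^{\,p-1}$, the automorphism $c$ fixes every word of length $1$ and has sections $a^{e_1},\dots,a^{e_{p-1}},c$ at the words $1,\dots,p-1,p$ respectively. For $n\ge 0$ let $G_n=G/\mathrm{St}_G(n)$, where $\mathrm{St}_G(n)$ is the subgroup of the elements of $G$ that fix every word of length $n$; it is a finite group. If $G$ is a periodic GGS-group (that is, every element of $G$ has finite order), then for every integer $n\ge 1$ $$\exp(G_{n+2})\ \ge\ p\cdot\exp(G_n).$$ -/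

import Mathlib

/-- The group `Aut 𝒯` of automorphisms of the `p`-adic rooted tree `𝒯`. The vertices of `𝒯` are the
finite words in an alphabet with `p` letters, the empty word being the root. The letters `1, …, p`
are represented by their residues modulo `p`, so that the letter `p` is `0 : ZMod p`. An automorphism
is a bijection of the set of words that preserves levels and the relation of being a prefix.
(Multiplication is composition of maps with the right factor applied first.) -/
def treeAut (p : ℕ) : Subgroup (Equiv.Perm (List (ZMod p))) where
  carrier := {g | (∀ u, (g u).length = u.length) ∧ ∀ u v, g u <+: g v ↔ u <+: v}
  one_mem' := ⟨fun _ => rfl, fun _ _ => Iff.rfl⟩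
  mul_mem' := by
    rintro g h ⟨hg, hg'⟩ ⟨hh, hh'⟩
    exact ⟨fun u => (hg (h u)).trans (hh u), fun u v => (hg' (h u) (h v)).trans (hh' u v)⟩
  inv_mem' := by
    rintro g ⟨hg, hg'⟩
    refine ⟨fun u => ?_, fun u v => ?_⟩
    · simpa using (hg (g⁻¹ u)).symm
    · simpa using (hg' (g⁻¹ u) (g⁻¹ v)).symm

/-- The stabilizer `St(n)` of the `n`-th level: the automorphisms fixing all words of length `n`. -/
def levelStabilizer (p n : ℕ) : Subgroup (treeAut p) where
  carrier := {g | ∀ u : List (ZMod p), u.length = n → g.1 u = u}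
  one_mem' := fun _ _ => rfl
  mul_mem' := by
    intro g h hg hh u hu
    change g.1 (h.1 u) = u
    rw [hh u hu, hg u hu]
  inv_mem' := by
    intro g hg u hu
    exact (Equiv.Perm.inv_eq_iff_eq).2 (hg u hu).symm

instance levelStabilizer_normal (p n : ℕ) : (levelStabilizer p n).Normal := by
  refine ⟨fun g hg h u hu => ?_⟩
  change h.1 (g.1 ((h.1)⁻¹ u)) = u
  have h1 : ((h.1)⁻¹ u).length = n := ((h⁻¹).2.1 u).trans hu
  rw [hg _ h1]
  exact Equiv.apply_symm_apply h.1 u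

/-- The `n`-th congruence quotient `G_n = G / St_G(n)`, where `St_G(n) = St(n) ∩ G`. -/
abbrev CongruenceQuotient {p : ℕ} (G : Subgroup (treeAut p)) (n : ℕ) : Type :=
  G ⧸ (levelStabilizer p n).subgroupOf G

/-- Congruence quotients are finite, so that their exponents are positive integers. -/
instance congruenceQuotient_finite {p : ℕ} [NeZero p] (G : Subgroup (treeAut p)) (n : ℕ) :
    Finite (CongruenceQuotient G n) := by
  have hfin : Finite {u : List (ZMod p) // u.length = n} :=
    (List.finite_length_eq (ZMod p) n).to_subtype
  let f : CongruenceQuotient G n → {u : List (ZMod p) // u.length = n} →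
      {u : List (ZMod p) // u.length = n} :=
    fun q u => ⟨q.out.1.1 u.1, by rw [q.out.1.2.1 u.1, u.2]⟩
  refine Finite.of_injective f fun q r hqr => ?_
  rw [← q.out_eq', ← r.out_eq']
  refine QuotientGroup.eq.2 (Subgroup.mem_subgroupOf.2 fun u hu => ?_)
  change (q.out.1.1)⁻¹ (r.out.1.1 u) = u
  have h1 : q.out.1.1 u = r.out.1.1 u := congrArg Subtype.val (congrFun hqr ⟨u, hu⟩)
  rw [← h1]
  exact Equiv.symm_apply_apply q.out.1.1 u

/-- The rooted automorphism `a`: its label at the root is the cycle `(1 2 … p)` (that is, `x ↦ x + 1`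
modulo `p`) and all its other labels are trivial. -/
def rootedAut (p : ℕ) : treeAut p :=
  ⟨{ toFun := fun u => match u with
       | [] => []
       | x :: w => (x + 1) :: w
     invFun := fun u => match u with
       | [] => []
       | x :: w => (x - 1) :: w
     left_inv := by rintro (_ | ⟨x, w⟩) <;> simp
     right_inv := by rintro (_ | ⟨x, w⟩) <;> simp },
    by
      refine ⟨?_, ?_⟩
      · rintro (_ | ⟨x, w⟩) <;> simp
      · rintro (_ | ⟨x, w⟩) (_ | ⟨y, v⟩) <;> simp [List.cons_prefix_cons]⟩

/-- Vectors `(e_1, …, e_{p-1})` with entries in `𝔽_p`; the indices `1, …, p-1` are represented by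
the non-zero residues modulo `p`. -/
abbrev DefVec (p : ℕ) : Type := {i : ZMod p // i ≠ 0} → ZMod p

/-- The action on words of the directed automorphism `b` along the path `P_j = (∅, j, jj, …)` with
defining vector `e`. It fixes the letters of the first level, its section at `j` is `b` itself, and
its section at any letter `x ≠ j` is `a ^ e_{x - j}`, the index being taken modulo `p`. That is,
`ψ(b) = (a ^ e_{p-j+1}, …, a ^ e_{p-1}, b, a ^ e_1, …, a ^ e_{p-j})`, with `b` in position `j`. -/
def directedFun {p : ℕ} (j : ZMod p) (e : DefVec p) : List (ZMod p) → List (ZMod p)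
  | [] => []
  | x :: w =>
    x :: (if h : x = j then directedFun j e w
      else (rootedAut p ^ (e ⟨x - j, sub_ne_zero.2 h⟩).val).1 w)

/-- The action on words of the inverse of the directed automorphism along `P_j`. -/
def directedInvFun {p : ℕ} (j : ZMod p) (e : DefVec p) : List (ZMod p) → List (ZMod p)
  | [] => []
  | x :: w =>
    x :: (if h : x = j then directedInvFun j e w
      else ((rootedAut p ^ (e ⟨x - j, sub_ne_zero.2 h⟩).val).1)⁻¹ w)

/-- The directed automorphism along the path `P_j = (∅, j, jj, …)` with defining vector `e`. -/
def directedAut {p : ℕ} (j : ZMod p) (e : DefVec p) : treeAut p :=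
  ⟨{ toFun := directedFun j e
     invFun := directedInvFun j e
     left_inv := by
       intro u
       induction u with
       | nil => rfl
       | cons x w ih => by_cases h : x = j <;> simp [directedFun, directedInvFun, h, ih]
     right_inv := by
       intro u
       induction u with
       | nil => rfl
       | cons x w ih => by_cases h : x = j <;> simp [directedFun, directedInvFun, h, ih] },
    by
      refine ⟨fun u => ?_, fun u => ?_⟩
      · change (directedFun j e u).length = u.length
        induction u with
        | nil => rfl
        | cons x w ih =>
          by_cases h : x = j
          · simp [directedFun, h, ih]
          · simpa [directedFun, h] using (rootedAut p ^ (e ⟨x - j, sub_ne_zero.2 h⟩).val).2.1 w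
      · change ∀ v, directedFun j e u <+: directedFun j e v ↔ u <+: v
        induction u with
        | nil => simp [directedFun]
        | cons x w ih =>
          rintro (_ | ⟨y, v⟩)
          · simp [directedFun]
          · simp only [directedFun, List.cons_prefix_cons]
            refine and_congr_right fun hxy => ?_
            subst hxy
            by_cases h : x = j
            · simpa [h] using ih v
            · simpa [h] using (rootedAut p ^ (e ⟨x - j, sub_ne_zero.2 h⟩).val).2.2 w v⟩

/-- The group `⟨a, B^(1), …, B^(p)⟩`, where `B^(j)` is the set of all directed automorphisms along
`P_j` with defining vector in `E^(j)`. It is the multi-EGS-group associated to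
`E = (E^(1), …, E^(p))` when the subspaces `E^(j)` are not all null. -/
def multiEGSGroup {p : ℕ} (E : ZMod p → Submodule (ZMod p) (DefVec p)) : Subgroup (treeAut p) :=
  Subgroup.closure ({rootedAut p} ∪ ⋃ j, directedAut j '' (E j : Set (DefVec p)))

/-- `G` is a GGS-group: a multi-EGS-group for which `E^(1), …, E^(p-1)` are null and `E^(p)` has
dimension `1` (the index `p` being `0` modulo `p`). -/
def IsGGSGroup {p : ℕ} (G : Subgroup (treeAut p)) : Prop :=
  ∃ E : ZMod p → Submodule (ZMod p) (DefVec p),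
    (∀ j, j ≠ 0 → E j = ⊥) ∧ Module.finrank (ZMod p) (E 0) = 1 ∧ G = multiEGSGroup E

/-! Write `a` for the rooted generator and `b` for a directed one, with exponents `ε x` summing to
`σ`. If `σ ≠ 0`, the `p`-th power of `a ^ σ * b` has a section conjugate to `a ^ σ * b`, so this
element has infinite order; periodicity thus forces `σ = 0` (`sum_eq_zero`).

The key is `exists_pow_section_eq`: each `g` in the group is a second-level section of the `p`-th
power of some `a * spread p f` in the group. Then `N = exp(G_{n+2})` is divisible by `p`, because `a
* spread p f` moves the first level in a `p`-cycle, and passing to sections in its `N`-th power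
gives `g ^ (N / p) ∈ St(n)`. Hence `exp(G_n)` divides `N / p`.

To find `f`, let `L` be `ristSection b`, a normal subgroup by fractality. Modulo `L` the group has
class at most two (`IsDirectedAut.commutator_mem_center`). Lift `g` to some `spread p t` with
section `g`; modulo `L` it is `b ^ j * ⁅a, b⁆ ^ k`, and `j` can be made non-zero, so it is conjugate
to `b ^ j` by a power of `a`. So a conjugate of `spread p t` is `b ^ j * z` with `z ∈ L`. By
definition of `L`, multiplying the section at `0` of `b ^ j` by `z` stays in the group; since `σ =
0`, that section appears unchanged in the `p`-th power. -/

open scoped commutatorElement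

/-! ### Sections and powers of tree automorphisms -/

section

variable {p : ℕ}

/-- The element of the first level stabilizer of `Aut 𝒯` with prescribed sections. -/
def spread (p : ℕ) : (ZMod p → treeAut p) →* treeAut p where
  toFun f := ⟨{ toFun := fun u => match u with
                  | [] => []
                  | x :: w => x :: (f x).1 w
                invFun := fun u => match u with
                  | [] => []
                  | x :: w => x :: ((f x).1)⁻¹ w
                left_inv := by rintro (_ | ⟨x, w⟩) <;> simp
                right_inv := by rintro (_ | ⟨x, w⟩) <;> simp },
    by
      refine ⟨?_, ?_⟩
      · rintro (_ | ⟨x, w⟩)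
        · simp
        · simpa using (f x).2.1 w
      · rintro (_ | ⟨x, w⟩) (_ | ⟨y, v⟩)
        · simp
        · simp
        · simp
        · simp only [Equiv.coe_fn_mk, List.cons_prefix_cons]
          refine and_congr_right fun hxy => ?_
          subst hxy
          exact (f x).2.2 w v⟩
  map_one' := by
    apply Subtype.ext
    ext1 u
    rcases u with _ | ⟨x, w⟩ <;> rfl
  map_mul' f g := by
    apply Subtype.ext
    ext1 u
    rcases u with _ | ⟨x, w⟩ <;> rfl

theorem treeAut_ext {g h : treeAut p} (H : ∀ u, g.1 u = h.1 u) : g = h :=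
  Subtype.ext (Equiv.ext H)

theorem treeAut_apply_nil (g : treeAut p) : g.1 [] = [] :=
  List.length_eq_zero_iff.1 (g.2.1 [])

theorem treeAut_mul_apply (g h : treeAut p) (u : List (ZMod p)) : (g * h).1 u = g.1 (h.1 u) := rfl

@[simp] theorem spread_apply_cons (f : ZMod p → treeAut p) (x : ZMod p) (w : List (ZMod p)) :
    (spread p f).1 (x :: w) = x :: (f x).1 w := rfl

theorem spread_injective : Function.Injective (spread p) := by
  intro f g h
  funext x
  refine treeAut_ext fun w => ?_
  have := congrArg (fun t : treeAut p => t.1 (x :: w)) h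
  simpa using this

theorem mem_of_spread_mem {f : ZMod p → treeAut p} {n : ℕ}
    (h : spread p f ∈ levelStabilizer p (n + 1)) (x : ZMod p) : f x ∈ levelStabilizer p n := by
  intro u hu
  have := h (x :: u) (by simp [hu])
  simpa using this

theorem rootedAut_pow_apply_cons (n : ℕ) (x : ZMod p) (w : List (ZMod p)) :
    (rootedAut p ^ n).1 (x :: w) = (x + n) :: w := by
  induction n with
  | zero => simp
  | succ n ih =>
    rw [pow_succ', treeAut_mul_apply, ih]
    change (x + n + 1) :: w = _
    push_cast
    ring_nf

theorem rootedAut_pow_self : rootedAut p ^ p = 1 := by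
  refine treeAut_ext fun u => ?_
  rcases u with _ | ⟨x, w⟩
  · rw [treeAut_apply_nil, treeAut_apply_nil]
  · rw [rootedAut_pow_apply_cons]
    simp

variable [Fact p.Prime]

/-- The powers of the rooted automorphism, with exponents in `ZMod p`. -/
def rootedPow (k : ZMod p) : treeAut p := rootedAut p ^ k.val

@[simp] theorem rootedPow_apply_cons (k x : ZMod p) (w : List (ZMod p)) :
    (rootedPow k).1 (x :: w) = (x + k) :: w := by
  rw [rootedPow, rootedAut_pow_apply_cons, ZMod.natCast_zmod_val]

theorem rootedPow_natCast (n : ℕ) : rootedPow (n : ZMod p) = rootedAut p ^ n := by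
  rw [rootedPow, ZMod.val_natCast, ← pow_eq_pow_mod n rootedAut_pow_self]

@[simp] theorem rootedPow_zero : rootedPow (0 : ZMod p) = 1 := by simp [rootedPow]

theorem rootedPow_add (k l : ZMod p) : rootedPow (k + l) = rootedPow k * rootedPow l := by
  rw [rootedPow, ZMod.val_add, ← pow_eq_pow_mod _ rootedAut_pow_self, pow_add]
  rfl

theorem rootedPow_neg (k : ZMod p) : rootedPow (-k) = (rootedPow k)⁻¹ := by
  rw [eq_inv_iff_mul_eq_one, ← rootedPow_add]
  simp

theorem rootedPow_pow (k : ZMod p) (n : ℕ) : rootedPow k ^ n = rootedPow ((n : ZMod p) * k) := by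
  induction n with
  | zero => simp
  | succ n ih =>
    rw [pow_succ, ih, ← rootedPow_add]
    push_cast
    ring_nf

theorem rootedPow_commute (k l : ZMod p) : Commute (rootedPow k) (rootedPow l) := by
  rw [commute_iff_eq, ← rootedPow_add, ← rootedPow_add, add_comm]

theorem spread_mul_rootedPow (f : ZMod p → treeAut p) (k : ZMod p) :
    spread p f * rootedPow k = rootedPow k * spread p (fun x => f (x + k)) := by
  refine treeAut_ext fun u => ?_
  rcases u with _ | ⟨x, w⟩
  · rw [treeAut_apply_nil, treeAut_apply_nil]
  · simp

theorem rootedPow_conj_spread (f : ZMod p → treeAut p) (k : ZMod p) :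
    rootedPow k * spread p f * (rootedPow k)⁻¹ = spread p (fun x => f (x - k)) := by
  rw [mul_inv_eq_iff_eq_mul, spread_mul_rootedPow]
  simp

theorem eq_zero_of_rootedPow_mul_mem {k : ZMod p} {f : ZMod p → treeAut p} {n : ℕ}
    (h : rootedPow k * spread p f ∈ levelStabilizer p (n + 1)) : k = 0 := by
  have := h (0 :: List.replicate n 0) (by simp)
  rw [treeAut_mul_apply] at this
  simp only [spread_apply_cons, rootedPow_apply_cons, List.cons.injEq] at this
  simpa using this.1

/-- The section of `(rootedPow k * spread p f) ^ n` at `x`. -/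
def orbitProd (k : ZMod p) (f : ZMod p → treeAut p) (n : ℕ) (x : ZMod p) : treeAut p :=
  match n with
  | 0 => 1
  | n + 1 => f (x + n * k) * orbitProd k f n x

theorem rootedPow_mul_spread_pow (k : ZMod p) (f : ZMod p → treeAut p) (n : ℕ) :
    (rootedPow k * spread p f) ^ n = rootedPow ((n : ZMod p) * k) * spread p (orbitProd k f n) := by
  induction n with
  | zero =>
    have : orbitProd k f 0 = 1 := rfl
    simp [this]
  | succ n ih =>
    rw [pow_succ', ih, mul_assoc, ← mul_assoc (spread p f), spread_mul_rootedPow, mul_assoc,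
      ← map_mul, ← mul_assoc, ← rootedPow_add]
    congr 2
    · push_cast
      ring

theorem orbitProd_eq_rootedPow {k : ZMod p} {f : ZMod p → treeAut p} {φ : ZMod p → ZMod p}
    (x : ZMod p) (n : ℕ) (h : ∀ i < n, f (x + i * k) = rootedPow (φ (x + i * k))) :
    orbitProd k f n x = rootedPow (∑ i ∈ Finset.range n, φ (x + i * k)) := by
  induction n with
  | zero => simp [orbitProd]
  | succ n ih =>
    rw [orbitProd, ih fun i hi => h i (by omega), h n (by omega), Finset.sum_range_succ,
      ← rootedPow_add, add_comm]

theorem sum_range_mul_eq {k : ZMod p} (hk : k ≠ 0) (φ : ZMod p → ZMod p)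
    (h0 : φ 0 = 0) : ∑ i ∈ Finset.range (p - 1), φ (k + i * k) = ∑ y, φ y := by
  have hp : p - 1 + 1 = p := Nat.sub_add_cancel (Fact.out : p.Prime).one_le
  have h1 : ∑ i ∈ Finset.range p, φ (i * k) = ∑ y, φ y := by
    refine Finset.sum_bij (fun i _ => (i : ZMod p) * k) (fun _ _ => Finset.mem_univ _) ?_ ?_
      (fun _ _ => rfl)
    · intro i hi j hj hij
      have h2 := mul_right_cancel₀ hk hij
      rw [ZMod.natCast_eq_natCast_iff'] at h2
      rwa [Nat.mod_eq_of_lt (Finset.mem_range.1 hi), Nat.mod_eq_of_lt (Finset.mem_range.1 hj)] at h2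
    · intro y _
      exact ⟨(y / k).val, Finset.mem_range.2 (ZMod.val_lt _), by simp [hk]⟩
  have h2 := Finset.sum_range_succ' (fun i : ℕ => φ ((i : ZMod p) * k)) (p - 1)
  rw [hp] at h2
  rw [← h1, h2]
  simp only [Nat.cast_zero, zero_mul, h0, add_zero]
  refine Finset.sum_congr rfl fun i _ => ?_
  congr 1
  push_cast
  ring

/-- If the sections of `f` away from the letter `0` are rooted, the `p`-th power of
`rootedPow k * spread p f` has a section that is `f 0` times a rooted automorphism. -/
theorem exists_rootedPow_mul_spread_pow_prime {k : ZMod p} (hk : k ≠ 0)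
    {f : ZMod p → treeAut p} {φ : ZMod p → ZMod p} (h0 : φ 0 = 0)
    (hf : ∀ y, y ≠ 0 → f y = rootedPow (φ y)) :
    ∃ f', (rootedPow k * spread p f) ^ p = spread p f' ∧ f' k = f 0 * rootedPow (∑ y, φ y) := by
  refine ⟨orbitProd k f p, by simp [rootedPow_mul_spread_pow], ?_⟩
  have hp : p - 1 + 1 = p := Nat.sub_add_cancel (Fact.out : p.Prime).one_le
  have hcast : ((p - 1 : ℕ) : ZMod p) + 1 = 0 := by
    have := congrArg (Nat.cast : ℕ → ZMod p) hp
    simpa using this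
  -- The orbit started at `k` visits `k, 2k, …, (p - 1)k` and reaches `0` only at the last step, so
  -- `f 0` is the leftmost factor and all others are rooted.
  have h1 : orbitProd k f (p - 1 + 1) k = f 0 * rootedPow (∑ y, φ y) := by
    rw [orbitProd, orbitProd_eq_rootedPow (φ := φ), sum_range_mul_eq hk φ h0]
    · congr 2
      linear_combination k * hcast
    · intro i hi
      apply hf
      have h2 : (k + i * k : ZMod p) = ((i + 1 : ℕ) : ZMod p) * k := by push_cast; ring
      rw [h2]
      refine mul_ne_zero ?_ hk
      rw [Ne, ZMod.natCast_eq_zero_iff]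
      exact Nat.not_dvd_of_pos_of_lt (by omega) (by omega)
  rwa [hp] at h1

end

/-! ### Two-generator groups with central commutator -/

section ClassTwo

variable {p : ℕ} {Q : Type*} [Group Q]

theorem zpow_eq_zpow_of_cast_eq {y : Q} (hy : y ^ p = 1) {m n : ℤ}
    (h : (m : ZMod p) = (n : ZMod p)) : y ^ m = y ^ n := by
  obtain ⟨k, hk⟩ := (ZMod.intCast_eq_intCast_iff_dvd_sub m n p).1 h
  obtain rfl : n = m + p * k := by linarith
  rw [zpow_add, zpow_mul, zpow_natCast, hy, one_zpow, mul_one]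

theorem pow_conj_eq_of_central {a b : Q} (hc : ⁅a, b⁆ ∈ Subgroup.center Q) (n : ℕ) :
    a ^ n * b * (a ^ n)⁻¹ = ⁅a, b⁆ ^ n * b := by
  induction n with
  | zero => simp
  | succ n ih =>
    have h1 : a * b * a⁻¹ = ⁅a, b⁆ * b := by simp [commutatorElement_def]
    have h2 : a * ⁅a, b⁆ ^ n = ⁅a, b⁆ ^ n * a :=
      Subgroup.mem_center_iff.1 (pow_mem hc n) a
    calc a ^ (n + 1) * b * (a ^ (n + 1))⁻¹ = a * (a ^ n * b * (a ^ n)⁻¹) * a⁻¹ := by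
          rw [pow_succ']; group
      _ = ⁅a, b⁆ ^ n * (a * b * a⁻¹) := by rw [ih, ← mul_assoc, h2]; group
      _ = _ := by rw [h1, pow_succ]; group

theorem commutator_pow_of_central {a b : Q} (hc : ⁅a, b⁆ ∈ Subgroup.center Q) (n : ℕ) :
    ⁅a ^ n, b⁆ = ⁅a, b⁆ ^ n := by
  rw [commutatorElement_def, pow_conj_eq_of_central hc, mul_inv_cancel_right]

theorem commutator_pow_eq_one {a b : Q} (ha : a ^ p = 1)
    (hc : ⁅a, b⁆ ∈ Subgroup.center Q) : ⁅a, b⁆ ^ p = 1 := by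
  rw [← commutator_pow_of_central hc, ha, commutatorElement_one_left]

variable [Fact p.Prime]

theorem exists_zpow_zpow_eq {y : Q} (hy : y ^ p = 1) {n : ℤ} (hn : (n : ZMod p) ≠ 0) :
    ∃ m : ℤ, (y ^ n) ^ m = y := by
  refine ⟨((n : ZMod p)⁻¹).val, ?_⟩
  rw [← zpow_mul]
  refine (zpow_eq_zpow_of_cast_eq hy (n := 1) ?_).trans (zpow_one y)
  push_cast
  rw [ZMod.natCast_zmod_val, mul_inv_cancel₀ hn]

theorem commute_of_commute_zpow {x y : Q} (hy : y ^ p = 1) {n : ℤ} (hn : (n : ZMod p) ≠ 0)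
    (h : Commute x (y ^ n)) : Commute x y := by
  obtain ⟨m, hm⟩ := exists_zpow_zpow_eq hy hn
  exact hm ▸ h.zpow_right m

theorem mem_center_of_commute {a b x : Q} (hgen : Subgroup.closure {a, b} = ⊤)
    (ha : Commute x a) (hb : Commute x b) : x ∈ Subgroup.center Q := by
  have h : Subgroup.closure {a, b} ≤ Subgroup.centralizer {x} := by
    rw [Subgroup.closure_le]
    rintro y (rfl | rfl)
    · exact Subgroup.mem_centralizer_singleton_iff.2 ha.symm
    · exact Subgroup.mem_centralizer_singleton_iff.2 hb.symm
  refine Subgroup.mem_center_iff.2 fun g => ?_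
  have := h (hgen ▸ Subgroup.mem_top g)
  exact Subgroup.mem_centralizer_singleton_iff.1 this

/-- The exponents are invertible modulo `p`, so `⁅b, a ^ m⁆` commutes with both generators; `⁅a, b⁆`
is then a power of the central element `⁅a ^ m, b⁆`. -/
theorem commutator_mem_center {a b : Q} (ha : a ^ p = 1) (hb : b ^ p = 1)
    (hgen : Subgroup.closure {a, b} = ⊤) {m n k l : ℤ} (hm : (m : ZMod p) ≠ 0)
    (hn : (n : ZMod p) ≠ 0) (hk : (k : ZMod p) ≠ 0)
    (h1 : Commute ⁅b, a ^ m⁆ (a ^ n)) (h2 : Commute ⁅b, a ^ m⁆ (b ^ k * a ^ l)) :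
    ⁅a, b⁆ ∈ Subgroup.center Q := by
  have h3 := commute_of_commute_zpow ha hn h1
  have h4 : Commute ⁅b, a ^ m⁆ (b ^ k) := by
    have := h2.mul_right (h3.zpow_right (-l))
    simpa [mul_assoc] using this
  have h5 := mem_center_of_commute hgen h3 (commute_of_commute_zpow hb hk h4)
  have h6 : ⁅a ^ m, b⁆ ∈ Subgroup.center Q := by
    rw [← commutatorElement_inv]
    exact inv_mem h5
  obtain ⟨t, ht⟩ := exists_zpow_zpow_eq ha hm
  have h7 : (a ^ m) ^ ((t : ZMod p).val) = a := by
    rw [← zpow_natCast, ← zpow_mul]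
    refine Eq.trans ?_ ht
    rw [← zpow_mul]
    exact zpow_eq_zpow_of_cast_eq ha (by simp)
  have h8 := commutator_pow_of_central h6 ((t : ZMod p).val)
  rw [h7] at h8
  rw [h8]
  exact pow_mem h6 _

/-- The product of the two commuting elements is `b ^ (1 - k)`, which therefore commutes with `b *
(a ^ m)⁻¹`, hence with `a ^ m`; and `1 - k` is invertible modulo `p`. -/
theorem commute_of_commute_mul {a b : Q} (ha : a ^ p = 1) (hb : b ^ p = 1) {m k : ℤ}
    (hm : (m : ZMod p) ≠ 0) (hk : (k : ZMod p) ≠ 1)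
    (h : Commute (b * (a ^ m)⁻¹) (a ^ m * (b ^ k)⁻¹)) : Commute a b := by
  have h1 : Commute (b * (a ^ m)⁻¹) (b ^ (1 - k)) := by
    have := (Commute.refl (b * (a ^ m)⁻¹)).mul_right h
    rw [zpow_sub, zpow_one]
    simpa [mul_assoc] using this
  have h2 : Commute b (b ^ (1 - k)) := (Commute.refl b).zpow_right _
  have h3 : Commute (a ^ m) (b ^ (1 - k)) := by
    have := (h2.inv_left.mul_left h1).inv_left
    simpa using this
  have h4 : Commute (a ^ m) b := by
    refine commute_of_commute_zpow hb (n := 1 - k) ?_ h3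
    push_cast
    exact sub_ne_zero.2 hk.symm
  exact (commute_of_commute_zpow ha hm h4.symm).symm

theorem pow_conj_zpow_eq_of_central {a b : Q} (hc : ⁅a, b⁆ ∈ Subgroup.center Q) (n : ℕ) (j : ℤ) :
    a ^ n * b ^ j * (a ^ n)⁻¹ = b ^ j * ⁅a, b⁆ ^ (n * j) := by
  have h : Commute (⁅a, b⁆ ^ n) b := (Subgroup.mem_center_iff.1 (pow_mem hc n) b).symm
  rw [← conj_zpow, pow_conj_eq_of_central hc, h.mul_zpow, zpow_mul, zpow_natCast]
  exact (h.zpow_zpow j j).eq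

/-- The elements of the form `b ^ j * c ^ k` for fixed `j` multiply as expected if `c` is central. -/
theorem zpow_mul_zpow_mul {b c : Q} (hc : c ∈ Subgroup.center Q) (j k j' k' : ℤ) :
    (b ^ j * c ^ k) * (b ^ j' * c ^ k') = b ^ (j + j') * c ^ (k + k') := by
  have h : b ^ j' * c ^ k = c ^ k * b ^ j' := Subgroup.mem_center_iff.1 (zpow_mem hc k) _
  rw [zpow_add, zpow_add, mul_assoc, ← mul_assoc (c ^ k), ← h]
  group

theorem exists_eq_zpow_mul_zpow {a b : Q} (hc : ⁅a, b⁆ ∈ Subgroup.center Q) {q : Q}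
    (hq : q ∈ Subgroup.closure (Set.range fun n : ℕ => a ^ n * b * (a ^ n)⁻¹)) :
    ∃ j k : ℤ, q = b ^ j * ⁅a, b⁆ ^ k := by
  induction hq using Subgroup.closure_induction with
  | mem x hx =>
    obtain ⟨n, rfl⟩ := hx
    have := pow_conj_zpow_eq_of_central hc n 1
    exact ⟨1, n * 1, by simpa using this⟩
  | one => exact ⟨0, 0, by simp⟩
  | mul x y _ _ hx hy =>
    obtain ⟨j, k, rfl⟩ := hx
    obtain ⟨j', k', rfl⟩ := hy
    exact ⟨_, _, zpow_mul_zpow_mul hc j k j' k'⟩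
  | inv x _ hx =>
    obtain ⟨j, k, rfl⟩ := hx
    refine ⟨-j, -k, inv_eq_of_mul_eq_one_right ?_⟩
    rw [zpow_mul_zpow_mul hc]
    simp

/-- Conjugation by `a ^ n` multiplies `b ^ j` by `⁅a, b⁆ ^ (n * j)`, so `n * j = k` is solved modulo
`p`. -/
theorem exists_pow_conj_eq {a b : Q} (ha : a ^ p = 1) (hc : ⁅a, b⁆ ∈ Subgroup.center Q) {j : ℤ}
    (hj : (j : ZMod p) ≠ 0) (k : ℤ) :
    ∃ n : ℕ, a ^ n * b ^ j * (a ^ n)⁻¹ = b ^ j * ⁅a, b⁆ ^ k := by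
  refine ⟨((k : ZMod p) / j).val, ?_⟩
  rw [pow_conj_zpow_eq_of_central hc]
  congr 1
  refine zpow_eq_zpow_of_cast_eq (commutator_pow_eq_one ha hc) ?_
  push_cast
  rw [ZMod.natCast_zmod_val, div_mul_cancel₀ _ hj]

end ClassTwo

/-! ### The group, its fractality and its rigid sections -/

section

variable {p : ℕ}

/-- The group generated by the rooted automorphism and `b`. -/
def rootedClosure (b : treeAut p) : Subgroup (treeAut p) := Subgroup.closure {rootedAut p, b}

theorem rootedAut_mem (b : treeAut p) : rootedAut p ∈ rootedClosure b :=
  Subgroup.subset_closure (by simp)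

theorem self_mem_rootedClosure (b : treeAut p) : b ∈ rootedClosure b :=
  Subgroup.subset_closure (by simp)

theorem rootedPow_mem (b : treeAut p) (k : ZMod p) : rootedPow k ∈ rootedClosure b :=
  pow_mem (rootedAut_mem b) _

/-- The subgroup generated by the conjugates of `b` by rooted automorphisms. -/
def conjClosure (b : treeAut p) : Subgroup (treeAut p) :=
  Subgroup.closure (Set.range fun i : ZMod p => rootedPow i * b * (rootedPow i)⁻¹)

theorem conjClosure_le (b : treeAut p) : conjClosure b ≤ rootedClosure b := by
  refine (Subgroup.closure_le _).2 ?_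
  rintro _ ⟨i, rfl⟩
  exact mul_mem (mul_mem (rootedPow_mem b i) (self_mem_rootedClosure b))
    (inv_mem (rootedPow_mem b i))

/-- The rooted generator, as an element of the group. -/
def rootedGen (b : treeAut p) : rootedClosure b := ⟨rootedAut p, rootedAut_mem b⟩

/-- The directed generator, as an element of the group. -/
def dirGen (b : treeAut p) : rootedClosure b := ⟨b, self_mem_rootedClosure b⟩

theorem coe_rootedGen_pow (b : treeAut p) (k : ZMod p) :
    ((rootedGen b ^ (k.val : ℤ) : rootedClosure b) : treeAut p) = rootedPow k := by
  rw [zpow_natCast]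
  rfl

theorem closure_gens (b : treeAut p) :
    Subgroup.closure {rootedGen b, dirGen b} = (⊤ : Subgroup (rootedClosure b)) := by
  have h := Subgroup.closure_closure_coe_preimage (k := ({rootedAut p, b} : Set (treeAut p)))
  refine Eq.trans ?_ h
  congr 1
  ext x
  exact or_congr Subtype.ext_iff Subtype.ext_iff

theorem conjClosure_le_map {b : treeAut p} {Q : Type*} [Group Q] (π : rootedClosure b →* Q) :
    conjClosure b ≤ ((Subgroup.closure (Set.range fun n : ℕ =>
      π (rootedGen b) ^ n * π (dirGen b) * (π (rootedGen b) ^ n)⁻¹)).comap π).map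
      (rootedClosure b).subtype := by
  refine (Subgroup.closure_le _).2 ?_
  rintro _ ⟨i, rfl⟩
  refine ⟨rootedGen b ^ i.val * dirGen b * (rootedGen b ^ i.val)⁻¹, ?_, rfl⟩
  refine Subgroup.subset_closure ⟨i.val, ?_⟩
  simp

variable [Fact p.Prime]

/-- The sections of the conjugate by `rootedPow i` of an automorphism with section `b` at `0` and
rooted sections `rootedPow (ε x)` at the other letters `x`. -/
def dirSec (ε : ZMod p → ZMod p) (b : treeAut p) (i x : ZMod p) : treeAut p :=
  if x = i then b else rootedPow (ε (x - i))

theorem dirSec_self (ε : ZMod p → ZMod p) (b : treeAut p) (i : ZMod p) : dirSec ε b i i = b :=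
  if_pos rfl

theorem dirSec_of_ne (ε : ZMod p → ZMod p) (b : treeAut p) {i x : ZMod p} (h : x ≠ i) :
    dirSec ε b i x = rootedPow (ε (x - i)) :=
  if_neg h

/-- `b` is directed along the path `(0, 00, …)` with a non-zero defining vector `ε` and has order
dividing `p`. -/
structure IsDirectedAut (ε : ZMod p → ZMod p) (b : treeAut p) : Prop where
  zero : ε 0 = 0
  eq_spread : b = spread p (dirSec ε b 0)
  pow_eq_one : b ^ p = 1
  exists_ne : ∃ j, ε j ≠ 0

variable {ε : ZMod p → ZMod p} {b : treeAut p}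

namespace IsDirectedAut

theorem conj_eq (h : IsDirectedAut ε b) (i : ZMod p) :
    rootedPow i * b * (rootedPow i)⁻¹ = spread p (dirSec ε b i) := by
  conv_lhs => rw [h.eq_spread]
  rw [rootedPow_conj_spread]
  congr 1
  funext x
  simp [dirSec, sub_eq_zero]

theorem spread_dirSec_mem (h : IsDirectedAut ε b) (i : ZMod p) :
    dirSec ε b i ∈ (conjClosure b).comap (spread p) := by
  rw [Subgroup.mem_comap, ← h.conj_eq]
  exact Subgroup.subset_closure ⟨i, rfl⟩

/-- Fractality. -/
theorem exists_section_eq (h : IsDirectedAut ε b) {g : treeAut p} (hg : g ∈ rootedClosure b) :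
    ∃ f, spread p f ∈ conjClosure b ∧ f 0 = g := by
  have key : rootedClosure b ≤
      ((conjClosure b).comap (spread p)).map (Pi.evalMonoidHom _ (0 : ZMod p)) := by
    refine (Subgroup.closure_le _).2 ?_
    rintro _ (rfl | hx)
    · obtain ⟨j, hj⟩ := h.exists_ne
      have hj0 : j ≠ 0 := by rintro rfl; exact hj h.zero
      -- The conjugate of `b` with index `-j` has section `rootedPow (ε j)` at `0`; the exponent
      -- inverts `ε j`.
      refine ⟨dirSec ε b (-j) ^ ((ε j)⁻¹).val, pow_mem (h.spread_dirSec_mem _) _, ?_⟩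
      have h1 : (0 : ZMod p) ≠ -j := fun h => hj0 (by simpa using h.symm)
      rw [Pi.evalMonoidHom_apply, Pi.pow_apply, dirSec_of_ne _ _ h1, rootedPow_pow]
      have := rootedPow_natCast (p := p) 1
      simpa [hj] using this
    · exact ⟨dirSec ε b 0, h.spread_dirSec_mem _, (dirSec_self _ _ _).trans hx.symm⟩
  obtain ⟨f, hf, hfg⟩ := key hg
  exact ⟨f, hf, hfg⟩

/-- Some element of the group has infinite order unless the defining vector has sum zero. -/
theorem sum_eq_zero (h : IsDirectedAut ε b) (hper : ∀ g ∈ rootedClosure b, IsOfFinOrder g) :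
    ∑ x, ε x = 0 := by
  by_contra hσ
  set σ := ∑ x, ε x with hσdef
  have hmem : rootedPow σ * b ∈ rootedClosure b :=
    mul_mem (rootedPow_mem b σ) (self_mem_rootedClosure b)
  have hN := (hper _ hmem).orderOf_pos
  set N := orderOf (rootedPow σ * b) with hNdef
  have hpow : (rootedPow σ * b) ^ N = 1 := pow_orderOf_eq_one _
  have hdvd : p ∣ N := by
    rw [h.eq_spread, rootedPow_mul_spread_pow] at hpow
    have h0 : rootedPow ((N : ZMod p) * σ) * spread p (orbitProd σ (dirSec ε b 0) N) ∈
        levelStabilizer p (0 + 1) := by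
      rw [hpow]; exact one_mem _
    have := eq_zero_of_rootedPow_mul_mem h0
    rw [← ZMod.natCast_eq_zero_iff]
    exact (mul_eq_zero.1 this).resolve_right hσ
  obtain ⟨M, hM⟩ := hdvd
  -- The `p`-th power has section `b * rootedPow σ`, a conjugate of the original element, whose
  -- order `N = p * M` would then be at most `M`.
  obtain ⟨f', hf', hk⟩ := exists_rootedPow_mul_spread_pow_prime hσ (f := dirSec ε b 0) h.zero
    fun y hy => by rw [dirSec_of_ne _ _ hy, sub_zero]
  rw [← h.eq_spread] at hf'
  rw [dirSec_self, ← hσdef] at hk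
  have h1 : f' ^ M = 1 := by
    apply spread_injective
    rw [map_pow, ← hf', ← pow_mul, ← hM, hpow, map_one]
  have h2 : (b * rootedPow σ) ^ M = 1 := by
    rw [← hk, ← Pi.pow_apply, h1, Pi.one_apply]
  have h3 : (rootedPow σ * b) ^ M = 1 := by
    have h4 : rootedPow σ * b = rootedPow σ * (b * rootedPow σ) * (rootedPow σ)⁻¹ := by group
    rw [h4, conj_pow, h2]
    simp
  have hp := (Fact.out : p.Prime).two_le
  have hM0 : 0 < M := Nat.pos_of_ne_zero (by rintro rfl; omega)
  have := orderOf_le_of_pow_eq_one hM0 h3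
  nlinarith

end IsDirectedAut

/-- The elements `z` of the group such that the automorphism with section `z` at `0` and trivial
sections at the other letters belongs to the group. -/
def ristSection (b : treeAut p) : Subgroup (rootedClosure b) :=
  (((rootedClosure b).comap (spread p)).comap
    (MonoidHom.mulSingle (fun _ : ZMod p => treeAut p) 0)).subgroupOf (rootedClosure b)

theorem mem_ristSection {z : rootedClosure b} :
    z ∈ ristSection b ↔ spread p (Pi.mulSingle 0 (z : treeAut p)) ∈ rootedClosure b := Iff.rfl

namespace IsDirectedAut

/-- By fractality, conjugation by `g` at the letter `0` is induced by an element of the group fixing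
the first level. -/
theorem ristSection_normal (h : IsDirectedAut ε b) : (ristSection b).Normal := by
  refine ⟨fun z hz g => ?_⟩
  rw [mem_ristSection] at hz ⊢
  obtain ⟨f, hf, hfg⟩ := h.exists_section_eq g.2
  have h1 : (Pi.mulSingle 0 ((g * z * g⁻¹ : rootedClosure b) : treeAut p) : ZMod p → treeAut p) =
      f * Pi.mulSingle 0 (z : treeAut p) * f⁻¹ := by
    funext x
    by_cases hx : x = 0
    · subst hx
      simp [hfg]
    · simp [hx]
  rw [h1, map_mul, map_mul, map_inv]
  have hf' := conjClosure_le b hf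
  exact mul_mem (mul_mem hf' hz) (inv_mem hf')

end IsDirectedAut

/-- Source of all relations modulo `ristSection b`: if the supports of `f` and `y` meet at most at
`0`, their commutator is concentrated there. -/
theorem commutator_mem_ristSection {f y : ZMod p → treeAut p}
    (hf : spread p f ∈ rootedClosure b) (hy : spread p y ∈ rootedClosure b)
    (hfy : ∀ x, x ≠ 0 → f x = 1 ∨ y x = 1) {u v : rootedClosure b} (hu : f 0 = u) (hv : y 0 = v) :
    ⁅u, v⁆ ∈ ristSection b := by
  rw [mem_ristSection]
  have h1 : (Pi.mulSingle 0 ((⁅u, v⁆ : rootedClosure b) : treeAut p) : ZMod p → treeAut p) =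
      ⁅f, y⁆ := by
    funext x
    by_cases hx : x = 0
    · subst hx
      simp [commutatorElement_def, hu, hv]
    · rcases hfy x hx with h | h <;> simp [hx, commutatorElement_def, h]
  rw [h1, map_commutatorElement, commutatorElement_def]
  exact mul_mem (mul_mem (mul_mem hf hy) (inv_mem hf)) (inv_mem hy)

end

/-! ### The quotient by `ristSection b` has class at most two -/

section

variable {p : ℕ} [Fact p.Prime] {ε : ZMod p → ZMod p} {b : treeAut p}

namespace IsDirectedAut

/-- A constant value `c` off `0` would give the sum `(p - 1) * c = -c`, forcing `c = 0`. -/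
theorem exists_apply_ne (h : IsDirectedAut ε b) (hσ : ∑ x, ε x = 0) :
    ∃ i k, i ≠ 0 ∧ k ≠ 0 ∧ ε i ≠ ε k := by
  by_contra! hcon
  obtain ⟨j, hj⟩ := h.exists_ne
  have hj0 : j ≠ 0 := by rintro rfl; exact hj h.zero
  have h1 : ∀ x, ε x + (if x = 0 then ε j else 0) = ε j := by
    intro x
    by_cases hx : x = 0
    · simp [hx, h.zero]
    · simpa [hx] using hcon x j hx hj0
  have h2 := Finset.sum_congr rfl fun x (_ : x ∈ Finset.univ) => h1 x
  rw [Finset.sum_add_distrib, hσ] at h2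
  simp at h2
  exact hj h2

theorem two_ne_zero (h : IsDirectedAut ε b) (hσ : ∑ x, ε x = 0) : (2 : ZMod p) ≠ 0 := by
  obtain ⟨i, k, hi, hk, hik⟩ := h.exists_apply_ne hσ
  intro h2
  have hp : p ∣ 2 := (ZMod.natCast_eq_zero_iff 2 p).1 (by exact_mod_cast h2)
  have key : ∀ x y : ZMod 2, x ≠ 0 → y ≠ 0 → x = y := by decide
  obtain rfl : p = 2 := (Nat.prime_dvd_prime_iff_eq Fact.out Nat.prime_two).1 hp
  exact hik (by rw [key i k hi hk])

end IsDirectedAut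

/-- A quotient of powers of conjugates of a directed automorphism, given by its sections. -/
def dirQuot (ε : ZMod p → ZMod p) (b : treeAut p) (i m k n : ZMod p) : ZMod p → treeAut p :=
  dirSec ε b i ^ m.val * (dirSec ε b k ^ n.val)⁻¹

theorem dirQuot_apply {i m k n x : ZMod p} (hi : x ≠ i) (hk : x ≠ k) :
    dirQuot ε b i m k n x = rootedPow (m * ε (x - i) - n * ε (x - k)) := by
  rw [dirQuot, Pi.mul_apply, Pi.inv_apply, Pi.pow_apply, Pi.pow_apply, dirSec_of_ne _ _ hi,
    dirSec_of_ne _ _ hk, rootedPow_pow, rootedPow_pow, ← rootedPow_neg, ← rootedPow_add,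
    ZMod.natCast_zmod_val, ZMod.natCast_zmod_val, ← sub_eq_add_neg]

theorem dirQuot_apply_left {i m k n : ZMod p} (hk : i ≠ k) :
    dirQuot ε b i m k n i = b ^ m.val * (rootedPow (n * ε (i - k)))⁻¹ := by
  rw [dirQuot, Pi.mul_apply, Pi.inv_apply, Pi.pow_apply, Pi.pow_apply, dirSec_self,
    dirSec_of_ne _ _ hk, rootedPow_pow, ZMod.natCast_zmod_val]

theorem dirQuot_apply_right {i m k n : ZMod p} (hk : k ≠ i) :
    dirQuot ε b i m k n k = rootedPow (m * ε (k - i)) * (b ^ n.val)⁻¹ := by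
  rw [dirQuot, Pi.mul_apply, Pi.inv_apply, Pi.pow_apply, Pi.pow_apply, dirSec_self,
    dirSec_of_ne _ _ hk, rootedPow_pow, ZMod.natCast_zmod_val]

namespace IsDirectedAut

theorem dirQuot_mem (h : IsDirectedAut ε b) (i m k n : ZMod p) :
    spread p (dirQuot ε b i m k n) ∈ conjClosure b := by
  have : dirQuot ε b i m k n ∈ (conjClosure b).comap (spread p) :=
    mul_mem (pow_mem (h.spread_dirSec_mem i) _) (inv_mem (pow_mem (h.spread_dirSec_mem k) _))
  exact this

theorem apply_add_of_proportional (h : IsDirectedAut ε b) (hσ : ∑ x, ε x = 0) {j μ : ZMod p}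
    (hj : ε (-j) ≠ 0) (hμ : ∀ x, x ≠ 0 → x ≠ -j → ε x = μ * ε (x + j)) :
    ε (-j) = μ * ε j ∧ μ ≠ 1 := by
  have hj0 : j ≠ 0 := by rintro rfl; exact hj (by rw [neg_zero, h.zero])
  have hj1 : -j ≠ 0 := neg_ne_zero.2 hj0
  -- Both `ε` and its translate have sum zero, so the two exceptional terms, at `0` and `-j`, must
  -- cancel.
  have h1 : ∀ x, ε x - μ * ε (x + j) =
      (if x = 0 then -(μ * ε j) else 0) + (if x = -j then ε (-j) else 0) := by
    intro x
    by_cases hx : x = 0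
    · simp [hx, h.zero, hj1.symm]
    · by_cases hxj : x = -j
      · simp [hxj, hj0, h.zero]
      · simp [hx, hxj, ← hμ x hx hxj]
  have h2 : ∑ x, ε (x + j) = 0 := by
    rw [← hσ]
    exact Equiv.sum_comp (Equiv.addRight j) ε
  have h3 : ε (-j) = μ * ε j := by
    have h4 := Finset.sum_congr rfl fun x (_ : x ∈ Finset.univ) => h1 x
    rw [Finset.sum_sub_distrib, ← Finset.mul_sum, h2, hσ, Finset.sum_add_distrib] at h4
    simp only [Finset.sum_ite_eq', Finset.mem_univ, if_true] at h4
    linear_combination -h4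
  refine ⟨h3, ?_⟩
  rintro rfl
  rw [one_mul] at h3
  -- If `μ = 1`, filling the hole at `0` with `ε j` gives a function invariant under translation by
  -- `j`, hence constant, contrary to `exists_apply_ne`.
  set δ : ZMod p → ZMod p := fun x => if x = 0 then ε j else ε x with hδ
  have h5 : ∀ x, δ (x + j) = δ x := by
    intro x
    by_cases hx : x = 0
    · simp [hδ, hx]
    · by_cases hxj : x = -j
      · simp [hδ, hxj, hj0, h3]
      · have : x + j ≠ 0 := fun h => hxj (eq_neg_of_add_eq_zero_left h)
        simp [hδ, hx, this, hμ x hx hxj]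
  have h6 : ∀ n : ℕ, δ (n * j) = δ 0 := by
    intro n
    induction n with
    | zero => simp
    | succ n ih => rw [← ih, ← h5 (n * j)]; push_cast; ring_nf
  have h7 : ∀ x, x ≠ 0 → ε x = ε j := by
    intro x hx
    have := h6 (x / j).val
    rw [ZMod.natCast_zmod_val, div_mul_cancel₀ _ hj0] at this
    simpa [hδ, hx] using this
  obtain ⟨i, k, hi, hk, hik⟩ := h.exists_apply_ne hσ
  exact hik ((h7 i hi).trans (h7 k hk).symm)

/-- Modulo `ristSection b` the group has nilpotency class at most two. -/
theorem commutator_mem_center (h : IsDirectedAut ε b) (hσ : ∑ x, ε x = 0)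
    {Q : Type*} [Group Q] (π : rootedClosure b →* Q) (hπ : Function.Surjective π)
    (hker : ristSection b ≤ π.ker) :
    ⁅π (rootedGen b), π (dirGen b)⁆ ∈ Subgroup.center Q := by
  have hcomm : ∀ {f y : ZMod p → treeAut p}, spread p f ∈ rootedClosure b →
      spread p y ∈ rootedClosure b → (∀ x, x ≠ 0 → f x = 1 ∨ y x = 1) →
      ∀ {u v : rootedClosure b}, f 0 = u → y 0 = v → Commute (π u) (π v) := by
    intro f y hf hy hfy u v hu hv
    rw [← commutatorElement_eq_one_iff_commute, ← map_commutatorElement]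
    exact hker (commutator_mem_ristSection hf hy hfy hu hv)
  have ha : π (rootedGen b) ^ p = 1 := by
    have : rootedGen b ^ p = 1 := Subtype.ext rootedAut_pow_self
    rw [← map_pow, this, map_one]
  have hb : π (dirGen b) ^ p = 1 := by
    have : dirGen b ^ p = 1 := Subtype.ext h.pow_eq_one
    rw [← map_pow, this, map_one]
  have hgen : Subgroup.closure {π (rootedGen b), π (dirGen b)} = ⊤ := by
    rw [← Set.image_pair, ← MonoidHom.map_closure, closure_gens, ← MonoidHom.range_eq_map,
      MonoidHom.range_eq_top.2 hπ]
  have hmem : ∀ i m k n, spread p (dirQuot ε b i m k n) ∈ rootedClosure b :=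
    fun i m k n => conjClosure_le b (h.dirQuot_mem i m k n)
  have h2 := h.two_ne_zero hσ
  obtain ⟨j', hj'⟩ := h.exists_ne
  obtain ⟨j, rfl⟩ : ∃ j, j' = -j := ⟨-j', by simp⟩
  have hj0 : j ≠ 0 := by rintro rfl; exact hj' (by rw [neg_zero, h.zero])
  have hjj : j ≠ 2 * j := fun h => hj0 (by linear_combination -h)
  have h2j : 0 ≠ 2 * j := (mul_ne_zero h2 hj0).symm
  -- The determinant compares the sections at `0` and `j` of the conjugates with indices `i` and `2
  -- * j`. When it is non-zero, a combination of the two is trivial at `j` and a non-trivial power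
  -- of `a` at `0`.
  by_cases hdet : ∃ i, i ≠ 0 ∧ i ≠ j ∧ ε (-j) * ε (-i) - ε (j - i) * ε (-(2 * j)) ≠ 0
  · obtain ⟨i, hi0, hij, hi⟩ := hdet
    -- Rooted sections commute, so `f` is supported on `0` and `j`; its section at `0` commutes
    -- modulo `ristSection b` with that of any group element fixing the first level with trivial
    -- section at `j`.
    set f : ZMod p → treeAut p := ⁅dirSec ε b 0, dirSec ε b j⁆ with hf
    have hfmem : spread p f ∈ rootedClosure b := by
      have h0 := conjClosure_le b (h.spread_dirSec_mem 0)
      have h1 := conjClosure_le b (h.spread_dirSec_mem j)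
      rw [hf, map_commutatorElement, commutatorElement_def]
      exact mul_mem (mul_mem (mul_mem h0 h1) (inv_mem h0)) (inv_mem h1)
    have hf1 : ∀ x, x ≠ 0 → x ≠ j → f x = 1 := by
      intro x hx hxj
      change ⁅dirSec ε b 0 x, dirSec ε b j x⁆ = 1
      rw [commutatorElement_eq_one_iff_commute, dirSec_of_ne _ _ hx, dirSec_of_ne _ _ hxj]
      exact rootedPow_commute _ _
    have hf0 : f 0 = (⁅dirGen b, rootedGen b ^ ((ε (-j)).val : ℤ)⁆ : rootedClosure b) := by
      change ⁅dirSec ε b 0 0, dirSec ε b j 0⁆ = _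
      rw [dirSec_self, dirSec_of_ne _ _ hj0.symm, zero_sub]
      simp only [commutatorElement_def, Subgroup.coe_mul, Subgroup.coe_inv, coe_rootedGen_pow]
      rfl
    have hdisj : ∀ y : ZMod p → treeAut p, y j = 1 → ∀ x, x ≠ 0 → f x = 1 ∨ y x = 1 := by
      intro y hy x hx
      by_cases hxj : x = j
      · exact Or.inr (hxj ▸ hy)
      · exact Or.inl (hf1 x hx hxj)
    have c1 := hcomm hfmem (hmem i (ε (-j)) (2 * j) (ε (j - i)))
      (hdisj _ (by
        rw [dirQuot_apply hij.symm hjj, show j - 2 * j = -j by ring, mul_comm, sub_self,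
          rootedPow_zero])) hf0
      (v := rootedGen b ^ ((ε (-j) * ε (-i) - ε (j - i) * ε (-(2 * j))).val : ℤ))
      (by rw [dirQuot_apply hi0.symm h2j, coe_rootedGen_pow, zero_sub, zero_sub])
    have c2 := hcomm hfmem (hmem 0 (ε (-j)) (2 * j) (ε j))
      (hdisj _ (by
        rw [dirQuot_apply hj0 hjj, show j - 2 * j = -j by ring, sub_zero, mul_comm, sub_self,
          rootedPow_zero])) hf0
      (v := dirGen b ^ ((ε (-j)).val : ℤ) *
        rootedGen b ^ ((-(ε j * ε (-(2 * j)))).val : ℤ))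
      (by
        rw [dirQuot_apply_left h2j, Subgroup.coe_mul, coe_rootedGen_pow, zero_sub, rootedPow_neg,
          zpow_natCast]
        rfl)
    simp only [map_commutatorElement, map_mul, map_zpow] at c1 c2
    exact _root_.commutator_mem_center ha hb hgen (by simpa using hj') (by simpa using hi)
      (by simpa using hj') c1 c2
  · push Not at hdet
    -- All determinants vanish, so `ε` is proportional to its translate by `j` away from `0` and
    -- `-j`.
    have hμ : ∀ x, x ≠ 0 → x ≠ -j → ε x = ε (-(2 * j)) / ε (-j) * ε (x + j) := by
      intro x hx hxj
      have := hdet (-x) (neg_ne_zero.2 hx) (fun h => hxj (by rw [← h, neg_neg]))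
      rw [neg_neg, sub_neg_eq_add, add_comm j x] at this
      field_simp
      linear_combination this
    set μ := ε (-(2 * j)) / ε (-j)
    obtain ⟨hμj, hμ1⟩ := h.apply_add_of_proportional hσ hj' hμ
    have hjn : j ≠ -j := fun h => h2j (by linear_combination -h)
    -- By proportionality the first quotient is supported on `0` and `-j`; the second is its
    -- translate, supported on `j` and `0`. As `p` is odd, these supports meet only at `0`.
    have hc := hcomm (hmem 0 1 (-j) μ) (hmem j 1 0 μ) (u := dirGen b * (rootedGen b ^
        ((ε (-j)).val : ℤ))⁻¹) (v := rootedGen b ^ ((ε (-j)).val : ℤ) *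
        (dirGen b ^ (μ.val : ℤ))⁻¹)
      (by
        intro x hx
        by_cases hxj : x = -j
        · right
          rw [dirQuot_apply (by rw [hxj]; exact hjn.symm) hx, hxj, hμ (-j - j), sub_add_cancel,
            sub_zero, one_mul, sub_self, rootedPow_zero]
          · exact fun h => h2j (by linear_combination h)
          · exact fun h => hj0 (by linear_combination -h)
        · left
          rw [dirQuot_apply hx hxj, sub_zero, sub_neg_eq_add, ← hμ x hx hxj, one_mul, sub_self,
            rootedPow_zero])
      (by
        rw [dirQuot_apply_left (neg_ne_zero.2 hj0).symm, sub_neg_eq_add, zero_add, ← hμj,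
          ZMod.val_one, pow_one, Subgroup.coe_mul, Subgroup.coe_inv, coe_rootedGen_pow]
        rfl)
      (by
        rw [dirQuot_apply_right hj0.symm, zero_sub, one_mul, Subgroup.coe_mul, Subgroup.coe_inv,
          coe_rootedGen_pow, zpow_natCast]
        rfl)
    simp only [map_mul, map_zpow, map_inv] at hc
    have := commute_of_commute_mul ha hb (by simpa using hj') (by simpa using hμ1) hc
    rw [commutatorElement_eq_one_iff_commute.2 this]
    exact one_mem _

end IsDirectedAut

/-! ### Sections of `p`-th powers and the exponent bound -/

theorem rootedPow_zpow (k : ZMod p) (m : ℤ) : rootedPow k ^ m = rootedPow ((m : ZMod p) * k) := by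
  obtain ⟨n, rfl | rfl⟩ := m.eq_nat_or_neg
  · rw [zpow_natCast, rootedPow_pow, Int.cast_natCast]
  · rw [zpow_neg, zpow_natCast, rootedPow_pow, Int.cast_neg, Int.cast_natCast, neg_mul,
      rootedPow_neg]

namespace IsDirectedAut

/-- An element with trivial section at `0` that is congruent to a non-trivial power of `b`. -/
theorem exists_section_eq_one (h : IsDirectedAut ε b) (hσ : ∑ x, ε x = 0) :
    ∃ (r : ZMod p → treeAut p) (hr : spread p r ∈ rootedClosure b) (j : ℤ), r 0 = 1 ∧
      (j : ZMod p) ≠ 0 ∧ ∀ {Q : Type} [Group Q] (π : rootedClosure b →* Q),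
        ⁅π (rootedGen b), π (dirGen b)⁆ ∈ Subgroup.center Q →
        ∃ k : ℤ, π ⟨spread p r, hr⟩ =
          π (dirGen b) ^ j * ⁅π (rootedGen b), π (dirGen b)⁆ ^ k := by
  obtain ⟨i, k, hi, hk, hik⟩ := h.exists_apply_ne hσ
  -- At `0` the sections contribute `ε k * ε i - ε i * ε k = 0`, while the total exponent of `b` is
  -- `ε k - ε i ≠ 0`.
  refine ⟨dirQuot ε b (-i) (ε k) (-k) (ε i), conjClosure_le b (h.dirQuot_mem _ _ _ _),
    ((ε k).val : ℤ) + -((ε i).val : ℤ), ?_, ?_, ?_⟩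
  · rw [dirQuot_apply (neg_ne_zero.2 hi).symm (neg_ne_zero.2 hk).symm]
    simp [mul_comm]
  · simpa [← sub_eq_add_neg, sub_eq_zero] using hik.symm
  · intro Q _ π hc
    have h1 : (⟨spread p (dirQuot ε b (-i) (ε k) (-k) (ε i)),
        conjClosure_le b (h.dirQuot_mem _ _ _ _)⟩ : rootedClosure b) =
        (rootedGen b ^ (-i).val * dirGen b ^ ((ε k).val : ℤ) * (rootedGen b ^ (-i).val)⁻¹) *
        (rootedGen b ^ (-k).val * dirGen b ^ (-((ε i).val : ℤ)) *
          (rootedGen b ^ (-k).val)⁻¹) := by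
      apply Subtype.ext
      simp only [dirQuot, map_mul, map_inv, map_pow, ← h.conj_eq, conj_pow, zpow_neg, conj_inv,
        zpow_natCast]
      rfl
    rw [h1]
    simp only [map_mul, map_inv, map_pow, map_zpow]
    rw [pow_conj_zpow_eq_of_central hc, pow_conj_zpow_eq_of_central hc, zpow_mul_zpow_mul hc]
    exact ⟨_, rfl⟩

/-- Every element of the group is a section at the second level of the `p`-th power of an element
that acts on the first level as the rooted automorphism. -/
theorem exists_pow_section_eq (h : IsDirectedAut ε b) (hσ : ∑ x, ε x = 0) {g : treeAut p}
    (hg : g ∈ rootedClosure b) :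
    ∃ (f f' t : ZMod p → treeAut p) (y : ZMod p), rootedPow 1 * spread p f ∈ rootedClosure b ∧
      (rootedPow 1 * spread p f) ^ p = spread p f' ∧ f' 1 = spread p t ∧ t y = g := by
  have hn := h.ristSection_normal
  set π := QuotientGroup.mk' (ristSection b) with hπ
  have hker : π.ker = ristSection b := QuotientGroup.ker_mk' _
  have hc := h.commutator_mem_center hσ π (QuotientGroup.mk'_surjective _) hker.ge
  have ha : π (rootedGen b) ^ p = 1 := by
    have : rootedGen b ^ p = 1 := Subtype.ext rootedAut_pow_self
    rw [← map_pow, this, map_one]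
  obtain ⟨t, ht, ht0, j, hj, k, htπ⟩ : ∃ (t : ZMod p → treeAut p)
      (ht : spread p t ∈ rootedClosure b), t 0 = g ∧ ∃ j : ℤ, (j : ZMod p) ≠ 0 ∧ ∃ k : ℤ,
      π ⟨spread p t, ht⟩ = π (dirGen b) ^ j * ⁅π (rootedGen b), π (dirGen b)⁆ ^ k := by
    obtain ⟨t, ht, ht0⟩ := h.exists_section_eq hg
    obtain ⟨s, hs, hst⟩ := conjClosure_le_map π ht
    obtain ⟨j, k, hjk⟩ := exists_eq_zpow_mul_zpow hc hs
    have hs' : s = ⟨spread p t, conjClosure_le b ht⟩ := Subtype.ext hst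
    rw [hs'] at hjk
    -- If `j` vanishes modulo `p`, multiplying by `r` repairs it without changing the section at
    -- `0`.
    by_cases hj : (j : ZMod p) = 0
    · obtain ⟨r, hr, j', hr0, hj', hrπ⟩ := h.exists_section_eq_one hσ
      obtain ⟨k', hk'⟩ := hrπ π hc
      refine ⟨t * r, by rw [map_mul]; exact mul_mem (conjClosure_le b ht) hr, by simp [ht0, hr0],
        j + j', by simpa [hj] using hj', k + k', ?_⟩
      rw [← zpow_mul_zpow_mul hc, ← hjk, ← hk']
      refine Eq.trans ?_ (π.map_mul _ _)
      congr 1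
      exact Subtype.ext (map_mul _ _ _)
    · exact ⟨t, conjClosure_le b ht, ht0, j, hj, k, hjk⟩
  obtain ⟨n, hnj⟩ := exists_pow_conj_eq ha hc hj k
  rw [← htπ] at hnj
  set s : rootedClosure b := ⟨spread p t, ht⟩ with hs
  set z : rootedClosure b := (dirGen b ^ j)⁻¹ * ((rootedGen b ^ n)⁻¹ * s * rootedGen b ^ n) with hz
  have hzL : z ∈ ristSection b := by
    rw [← hker, MonoidHom.mem_ker, hz]
    simp only [map_mul, map_inv, map_pow, map_zpow, ← hnj]
    group
  rw [mem_ristSection] at hzL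
  -- Here `f 0 = b ^ j * z` is the conjugate of `spread p t` by a power of `a`, and the other
  -- sections are those of `b ^ j`, with exponents summing to zero.
  set f : ZMod p → treeAut p := dirSec ε b 0 ^ j * Pi.mulSingle 0 (z : treeAut p) with hf
  have hfmem : spread p f ∈ rootedClosure b := by
    rw [hf, map_mul, map_zpow]
    exact mul_mem (zpow_mem (conjClosure_le b (h.spread_dirSec_mem 0)) _) hzL
  obtain ⟨f', hf', hf1⟩ := exists_rootedPow_mul_spread_pow_prime (k := 1) one_ne_zero (f := f)
    (φ := fun y => (j : ZMod p) * ε y) (by simp [h.zero]) (by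
      intro y hy
      simp [hf, hy, dirSec_of_ne _ _ hy, rootedPow_zpow])
  refine ⟨f, f', fun x => t (x + n), -n, mul_mem (rootedPow_mem b 1) hfmem, hf', ?_, by
    simpa using ht0⟩
  rw [hf1, ← Finset.mul_sum, hσ, mul_zero, rootedPow_zero, mul_one]
  have h1 : f 0 = (rootedAut p ^ n)⁻¹ * spread p t * rootedAut p ^ n := by
    have h2 : f 0 = b ^ j * (z : treeAut p) := by simp [hf, dirSec_self]
    rw [h2, hz]
    change b ^ j * ((b ^ j)⁻¹ * ((rootedAut p ^ n)⁻¹ * spread p t * rootedAut p ^ n)) = _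
    rw [mul_inv_cancel_left]
  rw [h1, ← rootedPow_natCast, mul_assoc, spread_mul_rootedPow, inv_mul_cancel_left]

theorem exponent_mul_le (h : IsDirectedAut ε b) (hσ : ∑ x, ε x = 0) (n : ℕ) :
    Monoid.exponent (CongruenceQuotient (rootedClosure b) n) * p ≤
      Monoid.exponent (CongruenceQuotient (rootedClosure b) (n + 2)) := by
  set N := Monoid.exponent (CongruenceQuotient (rootedClosure b) (n + 2)) with hN
  have hN0 : N ≠ 0 := Monoid.exponent_ne_zero_of_finite
  have hmem : ∀ g ∈ rootedClosure b, g ^ N ∈ levelStabilizer p (n + 2) := by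
    intro g hg
    have h1 := Monoid.pow_exponent_eq_one
      (QuotientGroup.mk (⟨g, hg⟩ : rootedClosure b) : CongruenceQuotient (rootedClosure b) (n + 2))
    rw [← hN, ← QuotientGroup.mk_pow, QuotientGroup.eq_one_iff] at h1
    exact Subgroup.mem_subgroupOf.1 h1
  have hdvd : p ∣ N := by
    obtain ⟨f, -, -, -, hf, -⟩ := h.exists_pow_section_eq hσ (one_mem _)
    have h1 := hmem _ hf
    rw [rootedPow_mul_spread_pow, mul_one] at h1
    exact (ZMod.natCast_eq_zero_iff _ _).1 (eq_zero_of_rootedPow_mul_mem h1)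
  obtain ⟨M, hM⟩ := hdvd
  have hM0 : 0 < M := Nat.pos_of_ne_zero (by rintro rfl; exact hN0 (by rw [hM, mul_zero]))
  -- The `N`-th power of the chosen element is `spread p (f' ^ M)`; descending two levels reaches `g
  -- ^ M`.
  have hexp : Monoid.exponent (CongruenceQuotient (rootedClosure b) n) ∣ M := by
    refine Monoid.exponent_dvd_of_forall_pow_eq_one fun q => ?_
    obtain ⟨g, rfl⟩ := QuotientGroup.mk_surjective q
    rw [← QuotientGroup.mk_pow, QuotientGroup.eq_one_iff]
    obtain ⟨f, f', t, y, hf, hf', hf1, hty⟩ := h.exists_pow_section_eq hσ g.2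
    have h1 := hmem _ hf
    rw [hM, pow_mul, hf', ← map_pow] at h1
    have h2 := mem_of_spread_mem h1 1
    rw [Pi.pow_apply, hf1, ← map_pow] at h2
    have h3 := mem_of_spread_mem h2 y
    rw [Pi.pow_apply, hty] at h3
    exact Subgroup.mem_subgroupOf.2 h3
  rw [hM, mul_comm p]
  exact Nat.mul_le_mul_right p (Nat.le_of_dvd hM0 hexp)

end IsDirectedAut

/-! ### Reduction of GGS-groups to two generators -/

theorem directedAut_apply_cons (j : ZMod p) (e : DefVec p) (x : ZMod p) (w : List (ZMod p)) :
    (directedAut j e).1 (x :: w) = x :: (if h : x = j then (directedAut j e).1 w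
      else (rootedPow (e ⟨x - j, sub_ne_zero.2 h⟩)).1 w) := rfl

theorem directedAut_add (j : ZMod p) (e e' : DefVec p) :
    directedAut j (e + e') = directedAut j e * directedAut j e' := by
  refine treeAut_ext fun u => ?_
  induction u with
  | nil => simp only [treeAut_apply_nil]
  | cons x w ih =>
    rw [treeAut_mul_apply] at ih ⊢
    simp only [directedAut_apply_cons]
    by_cases h : x = j
    · simp only [h, dif_pos, ih]
    · simp only [h, dif_neg, not_false_iff, Pi.add_apply, rootedPow_add, treeAut_mul_apply]

theorem directedAut_zero (j : ZMod p) : directedAut j (0 : DefVec p) = 1 := by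
  have := directedAut_add j (0 : DefVec p) 0
  simpa using this

theorem directedAut_nsmul (j : ZMod p) (n : ℕ) (e : DefVec p) :
    directedAut j (n • e) = directedAut j e ^ n := by
  induction n with
  | zero => simp [directedAut_zero]
  | succ n ih => rw [succ_nsmul, directedAut_add, ih, pow_succ]

theorem isDirectedAut_directedAut {e : DefVec p} (he : e ≠ 0) :
    IsDirectedAut (fun x => if h : x = 0 then 0 else e ⟨x, h⟩) (directedAut 0 e) where
  zero := by simp
  eq_spread := by
    refine treeAut_ext fun u => ?_
    rcases u with _ | ⟨x, w⟩
    · simp only [treeAut_apply_nil]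
    · rw [directedAut_apply_cons, spread_apply_cons]
      by_cases h : x = 0
      · simp [h, dirSec_self]
      · simp [h, dirSec_of_ne]
  pow_eq_one := by
    rw [← directedAut_nsmul, ← Nat.cast_smul_eq_nsmul (ZMod p), CharP.cast_eq_zero, zero_smul,
      directedAut_zero]
  exists_ne := by
    obtain ⟨⟨j, hj⟩, h⟩ := Function.ne_iff.1 he
    exact ⟨j, by simpa [hj] using h⟩

/-- `directedAut` turns sums of vectors into products, so one spanning vector of the line `E 0`
yields all directed generators as powers. -/
theorem IsGGSGroup.exists_eq_rootedClosure {G : Subgroup (treeAut p)} (hG : IsGGSGroup G) :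
    ∃ e : DefVec p, e ≠ 0 ∧ G = rootedClosure (directedAut 0 e) := by
  obtain ⟨E, hE, hE0, rfl⟩ := hG
  obtain ⟨⟨e, heE⟩, he, hspan⟩ := finrank_eq_one_iff'.1 hE0
  refine ⟨e, fun h => he (Subtype.ext h), le_antisymm ?_ ?_⟩
  · refine (Subgroup.closure_le _).2 (Set.union_subset ?_ (Set.iUnion_subset fun j => ?_))
    · rintro _ rfl
      exact rootedAut_mem _
    · rintro _ ⟨e', he', rfl⟩
      by_cases hj : j = 0
      · subst hj
        obtain ⟨c, hc⟩ := hspan ⟨e', he'⟩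
        have h1 : e' = c.val • e := by
          rw [← Nat.cast_smul_eq_nsmul (ZMod p), ZMod.natCast_zmod_val]
          exact (congrArg Subtype.val hc).symm
        rw [h1, directedAut_nsmul]
        exact pow_mem (self_mem_rootedClosure _) _
      · rw [hE j hj] at he'
        obtain rfl : e' = 0 := he'
        rw [directedAut_zero]
        exact one_mem _
  · refine (Subgroup.closure_le _).2 ?_
    rintro _ (rfl | hx)
    · exact Subgroup.subset_closure (Or.inl rfl)
    · rw [Set.mem_singleton_iff.1 hx]
      exact Subgroup.subset_closure (Or.inr (Set.mem_iUnion.2 ⟨0, e, heE, rfl⟩))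

end

theorem lemmaL5 (p : ℕ) [Fact p.Prime] (G : Subgroup (treeAut p)) (hG : IsGGSGroup G)
    (hper : ∀ g : G, IsOfFinOrder g) (n : ℕ) (hn : 1 ≤ n) :
    Monoid.exponent (CongruenceQuotient G (n + 2)) ≥
      Monoid.exponent (CongruenceQuotient G n) * p := by
  obtain ⟨e, he, rfl⟩ := hG.exists_eq_rootedClosure
  have h := isDirectedAut_directedAut he
  refine h.exponent_mul_le (h.sum_eq_zero fun g hg => ?_) n
  exact Submonoid.isOfFinOrder_coe.2 (hper ⟨g, hg⟩)
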